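/- Let $\mathcal V$ be a complete and cocomplete symmetric monoidal closed category, with unit $I$, internal hom $[-,-]$ and underlying ordinary category locally small, equipped with a model structure making it a monoidal model category (the pushout-product $i\,\square\,j$ of two cofibrations is a cofibration, and is a weak equivalence if $i$ or $j$ is one), and suppose that $I$ is cofibrant. We use the following notions. An *interval* is a factorisation $I+I\xrightarrow{(d\ c)}J\xrightarrow{e}I$ of the codiagonal with $(d\ c)$ a cofibration and $e$ a weak equivalence. A morphism $f\colon X\to Y$ of $\mathcal V$ is *shrinkable* if there are a morphism $s\colon Y\to X$ with $fs=1_Y$, an interval $(J,d,c,e)$ and a morphism $h\colon J\to[X,X]$ such that $hd$ and $hc$ are the names $I\to[X,X]$ of $sf$ and $1_X$, and $[X,f]\circ h\colon J\to[X,Y]$ is the composite of $e$ with the name $I\to[X,Y]$ of $f$. Let $\mathcal E$ be the class of shrinkable morphisms. A $\mathcal V$-functor $U\colon\mathcal B\to\mathcal A$ has an *$\mathcal E$-weak left adjoint* if for each $A\in\mathcal A$ there are $A'\in\mathcal B$ and $\eta\colon A\to UA'$ such that for all $B\in\mathcal B$ the composite $\mathcal B(A',B)\xrightarrow{U}\mathcal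 A(UA',UB)\xrightarrow{\mathcal A(\eta,UB)}\mathcal A(A,UB)$ belongs to $\mathcal E$. For a small $\mathcal V$-category $\mathcal D$, a $\mathcal V$-natural transformation between $\mathcal V$-functors $\mathcal D\to\mathcal V$ is a trivial fibration if all its components are trivial fibrations in $\mathcal V$; a $\mathcal V$-functor (weight) $Q\colon\mathcal D\to\mathcal V$ is *cofibrant* if $[\mathcal D,\mathcal V](Q,p)$ is a trivial fibration in $\mathcal V$ for every trivial fibration $p$. Let $\mathcal I$ be the unit $\mathcal V$-category (one object, with endomorphism object $I$), and let $I\colon\mathcal I\to\mathcal V$ be the $\mathcal V$-functor selecting $I$. A $\mathcal V$-category $\mathcal B$ has *enough cofibrantly-weighted limits* if for each small $\mathcal V$-category $\mathcal D$ and each $\mathcal V$-functor $P\colon\mathcal D\to\mathcal I$ there is a chosen cofibrant weight $Q\colon\mathcal D\to\mathcal V$ with a trivial fibration $Q\to IP$ such that $\mathcal B$ has all $Q$-weighted limits; a $\mathcal V$-functor $U\colon\mathcal B\to\mathcal A$ *preserves* them if it preserves these $Q$-weighted limits. **Theorem.** Let $\mathcal B$ be a $\mathcal V$-category with powers (by all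 objects of $\mathcal V$) and enough cofibrantly-weighted limits, let $\mathcal A$ be a $\mathcal V$-category, and let $U\colon\mathcal B\to\mathcal A$ be a $\mathcal V$-functor that preserves the powers and the chosen cofibrantly-weighted limits. Then $U$ has an $\mathcal E$-weak left adjoint if and only if the underlying ordinary functor $U_0\colon\mathcal B_0\to\mathcal A_0$ satisfies the solution set condition: for each $A\in\mathcal A$ there is a small family of morphisms $f_i\colon A\to UB_i$ such that each morphism $A\to UB$ is of the form $Ug\circ f_i$ for some $i$ and some $g\colon B_i\to B$. -/

import Mathlib

open CategoryTheory Limits MonoidalCategory HomotopicalAlgebra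
open scoped CategoryTheory.MonoidalClosed

universe v u u₁ u₂

noncomputable section

namespace WeakAFT

/-! ### Monoidal model categories with cofibrant unit -/

/-- The compatibility between a closed symmetric monoidal structure and a model structure: the
pushout-product `i □ j` of two cofibrations is a cofibration, which is moreover a weak equivalence
if `i` or `j` is one; and the unit object is cofibrant. (The usual unit axiom of monoidal model
categories is automatic when the unit is cofibrant.) -/
class MonoidalModelCategory (V : Type u) [Category.{v} V] [MonoidalCategory V]
    [ModelCategory V] : Prop where
  cofibration_pushoutProduct {A B X Y : V} (i : A ⟶ B) (j : X ⟶ Y)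
    (hi : cofibrations V i) (hj : cofibrations V j) :
    cofibrations V ((Arrow.pushoutProduct.obj (Arrow.mk i)).obj (Arrow.mk j)).hom
  weakEquivalence_pushoutProduct_left {A B X Y : V} (i : A ⟶ B) (j : X ⟶ Y)
    (hi : trivialCofibrations V i) (hj : cofibrations V j) :
    weakEquivalences V ((Arrow.pushoutProduct.obj (Arrow.mk i)).obj (Arrow.mk j)).hom
  weakEquivalence_pushoutProduct_right {A B X Y : V} (i : A ⟶ B) (j : X ⟶ Y)
    (hi : cofibrations V i) (hj : trivialCofibrations V j) :
    weakEquivalences V ((Arrow.pushoutProduct.obj (Arrow.mk i)).obj (Arrow.mk j)).hom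
  isCofibrant_unit : IsCofibrant (𝟙_ V)

/-! ### Intervals and shrinkable morphisms -/

section Shrinkable

variable (V : Type u) [Category.{v} V] [MonoidalCategory V] [ModelCategory V]

/-- An interval: a factorisation `I + I ⟶ J ⟶ I` of the codiagonal of the unit object as a
cofibration followed by a weak equivalence. -/
structure Interval where
  /-- the underlying object -/
  J : V
  /-- the first endpoint -/
  d : 𝟙_ V ⟶ J
  /-- the second endpoint -/
  c : 𝟙_ V ⟶ J
  /-- the projection to the unit -/
  e : J ⟶ 𝟙_ V
  d_e : d ≫ e = 𝟙 _
  c_e : c ≫ e = 𝟙 _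
  cofibration_desc : cofibrations V (coprod.desc d c)
  weakEquivalence_e : weakEquivalences V e

/-- The shrinkable morphisms `f : X ⟶ Y` of `V` (regarded as a `V`-category): those admitting a
section `s`, together with a homotopy `h : J ⟶ [X, X]`, for some interval `J`, from `s ∘ f` to the
identity (`X ⟶ X` is transposed to `I ⟶ [X, X]` by `curry'`), such that `f ∘ h : J ⟶ [X, Y]` is
trivial, i.e. it is the constant homotopy at `f`. -/
def shrinkable [MonoidalClosed V] : MorphismProperty V := fun X Y f =>
  ∃ s : Y ⟶ X, s ≫ f = 𝟙 Y ∧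
    ∃ (J : Interval V) (h : J.J ⟶ (ihom X).obj X),
      J.d ≫ h = MonoidalClosed.curry' (f ≫ s) ∧
      J.c ≫ h = MonoidalClosed.curry' (𝟙 X) ∧
      h ≫ (ihom X).map f = J.e ≫ MonoidalClosed.curry' f

end Shrinkable

/-! ### Weak left adjoints -/

section WeakAdjoint

variable {V : Type u} [Category.{v} V] [MonoidalCategory V]
variable {A : Type u₂} [EnrichedCategory V A]

/-- Precomposition `A(Y, Z) ⟶ A(X, Z)` with a morphism `η : I ⟶ A(X, Y)` of the underlying
category. -/
def precomp {X Y : A} (η : 𝟙_ V ⟶ (X ⟶[V] Y)) (Z : A) : (Y ⟶[V] Z) ⟶ (X ⟶[V] Z) :=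
  (λ_ _).inv ≫ η ▷ _ ≫ eComp V X Y Z

variable {B : Type u₁} [EnrichedCategory V B]

/-- `η : X ⟶ U X'` is a weak reflection of `X` along `U` with respect to a class `E` of morphisms
of `V`: for all `Y`, the morphism `B(X', Y) ⟶ A(U X', U Y) ⟶ A(X, U Y)` induced by `U` and `η`
belongs to `E`. -/
def IsWeakReflection (E : MorphismProperty V) (U : EnrichedFunctor V B A) {X : A} {X' : B}
    (η : 𝟙_ V ⟶ (X ⟶[V] U.obj X')) : Prop :=
  ∀ Y : B, E (U.map X' Y ≫ precomp η (U.obj Y))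

/-- `U` has an `E`-weak left adjoint: every object has an `E`-weak reflection. -/
def HasWeakLeftAdjoint (E : MorphismProperty V) (U : EnrichedFunctor V B A) : Prop :=
  ∀ X : A, ∃ (X' : B) (η : 𝟙_ V ⟶ (X ⟶[V] U.obj X')), IsWeakReflection E U η

end WeakAdjoint

/-! ### Powers -/

section Powers

variable {V : Type u} [Category.{v} V] [MonoidalCategory V] [SymmetricCategory V]
  [MonoidalClosed V]
variable {B : Type u₁} [EnrichedCategory V B]

/-- The morphism `B(Z, P) ⟶ [X, B(Z, Y)]` induced by `ι : X ⟶ B(P, Y)`. -/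
def coneTranspose {X : V} {P Y : B} (ι : X ⟶ (P ⟶[V] Y)) (Z : B) :
    (Z ⟶[V] P) ⟶ (ihom X).obj (Z ⟶[V] Y) :=
  MonoidalClosed.curry ((β_ X (Z ⟶[V] P)).hom ≫ (Z ⟶[V] P) ◁ ι ≫ eComp V Z P Y)

/-- `ι : X ⟶ B(P, Y)` exhibits `P` as the power of `Y` by `X`. -/
def IsPower {X : V} {P Y : B} (ι : X ⟶ (P ⟶[V] Y)) : Prop :=
  ∀ Z : B, IsIso (coneTranspose ι Z)

variable (V B) in
/-- `B` has powers by all objects of `V`. -/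
def HasPowers : Prop :=
  ∀ (X : V) (Y : B), ∃ (P : B) (ι : X ⟶ (P ⟶[V] Y)), IsPower ι

/-- `U` preserves powers. -/
def PreservesPowers {A : Type u₂} [EnrichedCategory V A] (U : EnrichedFunctor V B A) : Prop :=
  ∀ ⦃X : V⦄ ⦃P Y : B⦄ (ι : X ⟶ (P ⟶[V] Y)), IsPower ι → IsPower (ι ≫ U.map P Y)

end Powers

/-! ### Auxiliary identities -/

section Aux

variable {V : Type u} [Category.{v} V] [MonoidalCategory V] [SymmetricCategory V]
variable {B : Type u₁} [EnrichedCategory V B]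

lemma comparison_aux {X L Y Y' : B} {q q' δ : V} (c : q ⟶ (L ⟶[V] Y)) (c' : q' ⟶ (L ⟶[V] Y'))
    (σ : δ ⟶ (Y ⟶[V] Y')) (a : q ⊗ δ ⟶ q')
    (h : a ≫ c' = c ▷ δ ≫ (L ⟶[V] Y) ◁ σ ≫ eComp V L Y Y') :
    q ◁ (β_ δ (X ⟶[V] L)).hom ≫ (α_ q (X ⟶[V] L) δ).inv ≫
        ((β_ q (X ⟶[V] L)).hom ≫ (X ⟶[V] L) ◁ c ≫ eComp V X L Y) ▷ δ ≫
          (X ⟶[V] Y) ◁ σ ≫ eComp V X Y Y' =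
      (α_ q δ (X ⟶[V] L)).inv ≫ a ▷ (X ⟶[V] L) ≫
        (β_ q' (X ⟶[V] L)).hom ≫ (X ⟶[V] L) ◁ c' ≫ eComp V X L Y' := by
  rw [BraidedCategory.braiding_naturality_left_assoc, ← MonoidalCategory.whiskerLeft_comp_assoc, h]
  simp only [MonoidalCategory.whiskerLeft_comp, comp_whiskerRight, Category.assoc,
    BraidedCategory.braiding_tensor_left_hom, Iso.inv_hom_id_assoc]
  rw [← e_assoc]
  simp only [← whisker_exchange_assoc, associator_inv_naturality_right_assoc,
    associator_inv_naturality_middle_assoc, Iso.hom_inv_id_assoc]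

end Aux

section Closed

variable {V : Type u} [Category.{v} V] [MonoidalCategory V] [MonoidalClosed V]

lemma uncurry_tensorHom_comp {S T x y z : V} (f : S ⟶ (ihom x).obj y) (g : T ⟶ (ihom y).obj z) :
    MonoidalClosed.uncurry ((f ⊗ₘ g) ≫ MonoidalClosed.comp x y z) =
      (α_ x S T).inv ≫ MonoidalClosed.uncurry f ▷ T ≫ MonoidalClosed.uncurry g := by
  rw [MonoidalClosed.uncurry_natural_left, MonoidalClosed.comp_eq, MonoidalClosed.uncurry_curry,
    MonoidalClosed.compTranspose_eq, MonoidalCategory.tensorHom_def]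
  simp only [MonoidalClosed.uncurry_eq, MonoidalCategory.whiskerLeft_comp, Category.assoc,
    comp_whiskerRight]
  rw [← associator_inv_naturality_middle_assoc, ← whisker_exchange_assoc,
    associator_inv_naturality_right_assoc]

end Closed

/-! ### Weights and the presheaf category `[D, V]` -/

section Weights

variable {V : Type u} [Category.{v} V] [MonoidalCategory V] [MonoidalClosed V]
variable {D : Type v} [EnrichedCategory V D]

variable (V D) in
/-- A weight on the small `V`-category `D` is a `V`-functor from `D` to `V`. -/
abbrev Weight := EnrichedFunctor V D V

/-- The action `D(d, d') ⟶ [F d, F d']` of a weight `F` on hom-objects. -/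
def Weight.hom (F : Weight V D) (d d' : D) : (d ⟶[V] d') ⟶ (ihom (F.obj d)).obj (F.obj d') :=
  F.map d d'

/-- A `V`-natural transformation `F ⟶ G` between weights, in terms of the components
`F d ⟶ G d`; naturality is the equality of two morphisms `D(d, d') ⟶ [F d, G d']`. -/
structure WeightHom (F G : Weight V D) where
  /-- the components -/
  app (d : D) : F.obj d ⟶ G.obj d
  naturality (d d' : D) :
    F.hom d d' ≫ (ihom (F.obj d)).map (app d') =
      G.hom d d' ≫ (MonoidalClosed.pre (app d)).app (G.obj d')

lemma WeightHom.uncurry_naturality {F G : Weight V D} (p : WeightHom F G) (d d' : D) :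
    MonoidalClosed.uncurry (F.hom d d') ≫ p.app d' =
      p.app d ▷ _ ≫ MonoidalClosed.uncurry (G.hom d d') := by
  rw [← MonoidalClosed.uncurry_natural_right, p.naturality, MonoidalClosed.uncurry_pre_app]

/-- A `V`-natural transformation of weights is a trivial fibration if it is so levelwise. -/
def WeightHom.IsTrivialFibration [ModelCategory V] {F G : Weight V D} (p : WeightHom F G) : Prop :=
  ∀ d : D, trivialFibrations V (p.app d)

/-- `D(d, d') ⊗ [F d', G d'] ⟶ [F d, G d']`, given by the action of `F`. -/
def actLeft (F G : Weight V D) (d d' : D) :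
    (d ⟶[V] d') ⊗ (ihom (F.obj d')).obj (G.obj d') ⟶ (ihom (F.obj d)).obj (G.obj d') :=
  F.hom d d' ▷ _ ≫ MonoidalClosed.comp (F.obj d) (F.obj d') (G.obj d')

lemma uncurry_actLeft (F G : Weight V D) (d d' : D) {T : V}
    (φ : T ⟶ (ihom (F.obj d')).obj (G.obj d')) :
    MonoidalClosed.uncurry ((d ⟶[V] d') ◁ φ ≫ actLeft F G d d') =
      (α_ _ _ _).inv ≫ MonoidalClosed.uncurry (F.hom d d') ▷ T ≫ MonoidalClosed.uncurry φ := by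
  rw [actLeft, ← tensorHom_def'_assoc, uncurry_tensorHom_comp]

variable [SymmetricCategory V]

/-- `D(d, d') ⊗ [F d, G d] ⟶ [F d, G d']`, given by the action of `G`. -/
def actRight (F G : Weight V D) (d d' : D) :
    (d ⟶[V] d') ⊗ (ihom (F.obj d)).obj (G.obj d) ⟶ (ihom (F.obj d)).obj (G.obj d') :=
  (β_ _ _).hom ≫ _ ◁ G.hom d d' ≫ MonoidalClosed.comp (F.obj d) (G.obj d) (G.obj d')

lemma uncurry_actRight (F G : Weight V D) (d d' : D) {T : V}
    (φ : T ⟶ (ihom (F.obj d)).obj (G.obj d)) :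
    MonoidalClosed.uncurry ((d ⟶[V] d') ◁ φ ≫ actRight F G d d') =
      F.obj d ◁ (β_ _ _).hom ≫ (α_ _ _ _).inv ≫ MonoidalClosed.uncurry φ ▷ _ ≫
        MonoidalClosed.uncurry (G.hom d d') := by
  rw [actRight, BraidedCategory.braiding_naturality_right_assoc, ← tensorHom_def_assoc,
    MonoidalClosed.uncurry_natural_left, uncurry_tensorHom_comp]

variable [HasLimits V]

/-- One of the two morphisms `∏ d, [F d, G d] ⟶ ∏ (d, d'), [D(d, d'), [F d, G d']]` defining the
object of `V`-natural transformations; it is given by the action of `G`. -/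
def natMapRight (F G : Weight V D) :
    (∏ᶜ fun d : D => (ihom (F.obj d)).obj (G.obj d)) ⟶
      ∏ᶜ fun p : D × D => (ihom (p.1 ⟶[V] p.2)).obj ((ihom (F.obj p.1)).obj (G.obj p.2)) :=
  Pi.lift fun p => Pi.π _ p.1 ≫ MonoidalClosed.curry (actRight F G p.1 p.2)

/-- The other one of the two morphisms `∏ d, [F d, G d] ⟶ ∏ (d, d'), [D(d, d'), [F d, G d']]`; it
is given by the action of `F`. -/
def natMapLeft (F G : Weight V D) :
    (∏ᶜ fun d : D => (ihom (F.obj d)).obj (G.obj d)) ⟶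
      ∏ᶜ fun p : D × D => (ihom (p.1 ⟶[V] p.2)).obj ((ihom (F.obj p.1)).obj (G.obj p.2)) :=
  Pi.lift fun p => Pi.π _ p.2 ≫ MonoidalClosed.curry (actLeft F G p.1 p.2)

/-- The hom-object `[D, V](F, G)` of `V`-natural transformations: the end of the `[F d, G d]`,
constructed as an equalizer. -/
def natObj (F G : Weight V D) : V :=
  equalizer (natMapRight F G) (natMapLeft F G)

/-- The projections of the end `[D, V](F, G)`. -/
def natObjπ (F G : Weight V D) (d : D) : natObj F G ⟶ (ihom (F.obj d)).obj (G.obj d) :=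
  equalizer.ι (natMapRight F G) (natMapLeft F G) ≫ Pi.π _ d

lemma natObj_condition (F G : Weight V D) (d d' : D) :
    (d ⟶[V] d') ◁ natObjπ F G d ≫ actRight F G d d' =
      (d ⟶[V] d') ◁ natObjπ F G d' ≫ actLeft F G d d' := by
  apply MonoidalClosed.curry_injective
  rw [MonoidalClosed.curry_natural_left, MonoidalClosed.curry_natural_left]
  have h := congrArg (· ≫ Pi.π _ (d, d'))
    (equalizer.condition (natMapRight F G) (natMapLeft F G))
  simp only [natMapRight, natMapLeft, Category.assoc, Pi.lift_π] at h
  exact (Category.assoc _ _ _).trans (h.trans (Category.assoc _ _ _).symm)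

/-- The universal property of the end `[D, V](F, G)`. -/
def natObjLift {F G : Weight V D} {T : V} (φ : ∀ d : D, T ⟶ (ihom (F.obj d)).obj (G.obj d))
    (hφ : ∀ d d' : D, (d ⟶[V] d') ◁ φ d ≫ actRight F G d d' =
      (d ⟶[V] d') ◁ φ d' ≫ actLeft F G d d') : T ⟶ natObj F G :=
  equalizer.lift (Pi.lift φ) (by
    refine Pi.hom_ext _ _ fun p => ?_
    have h := congrArg MonoidalClosed.curry (hφ p.1 p.2)
    rw [MonoidalClosed.curry_natural_left, MonoidalClosed.curry_natural_left] at h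
    simpa [natMapRight, natMapLeft] using h)

@[simp]
lemma natObjLift_π {F G : Weight V D} {T : V} (φ : ∀ d : D, T ⟶ (ihom (F.obj d)).obj (G.obj d))
    (hφ : ∀ d d' : D, (d ⟶[V] d') ◁ φ d ≫ actRight F G d d' =
      (d ⟶[V] d') ◁ φ d' ≫ actLeft F G d d') (d : D) :
    natObjLift φ hφ ≫ natObjπ F G d = φ d :=
  (equalizer.lift_ι_assoc _ _ _).trans (Pi.lift_π _ _)

lemma natObj_hom_ext {F G : Weight V D} {T : V} {f g : T ⟶ natObj F G}
    (h : ∀ d, f ≫ natObjπ F G d = g ≫ natObjπ F G d) : f = g :=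
  equalizer.hom_ext (Pi.hom_ext _ _ fun d =>
    (Category.assoc _ _ _).trans ((h d).trans (Category.assoc _ _ _).symm))

/-- The morphism `[D, V](Q, p) : [D, V](Q, F) ⟶ [D, V](Q, G)` given by composition with a
`V`-natural transformation `p : F ⟶ G`. -/
def natObjMap (Q : Weight V D) {F G : Weight V D} (p : WeightHom F G) :
    natObj Q F ⟶ natObj Q G :=
  natObjLift (fun d => natObjπ Q F d ≫ (ihom (Q.obj d)).map (p.app d)) (fun d d' => by
    apply MonoidalClosed.uncurry_injective
    have h := congrArg MonoidalClosed.uncurry (natObj_condition Q F d d')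
    rw [uncurry_actRight, uncurry_actLeft] at h
    rw [uncurry_actRight, uncurry_actLeft, MonoidalClosed.uncurry_natural_right,
      MonoidalClosed.uncurry_natural_right, comp_whiskerRight_assoc, ← p.uncurry_naturality]
    simpa only [Category.assoc] using congrArg (· ≫ p.app d') h)

/-- A weight `Q` is cofibrant if `[D, V](Q, p)` is a trivial fibration in `V` for each (levelwise)
trivial fibration `p : F ⟶ G` of weights. -/
def IsCofibrantWeight [ModelCategory V] (Q : Weight V D) : Prop :=
  ∀ ⦃F G : Weight V D⦄ (p : WeightHom F G), p.IsTrivialFibration →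
    trivialFibrations V (natObjMap Q p)

end Weights

/-! ### Weighted limits -/

section WeightedLimits

variable {V : Type u} [Category.{v} V] [MonoidalCategory V] [MonoidalClosed V]
variable {B : Type u₁} [EnrichedCategory V B]

variable (V) in
/-- The representable `V`-functor `B(X, -) : B ⟶ V`. -/
def representable (X : B) : EnrichedFunctor V B V where
  obj Y := X ⟶[V] Y
  map Y Z := MonoidalClosed.curry (eComp V X Y Z)
  map_id Y := by
    apply MonoidalClosed.uncurry_injective
    rw [MonoidalClosed.uncurry_natural_left]
    erw [MonoidalClosed.uncurry_curry, MonoidalClosed.uncurry_curry]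
    rw [← Iso.inv_comp_eq_id, e_comp_id]
  map_comp Y Z W := by
    apply MonoidalClosed.uncurry_injective
    refine Eq.trans ?_ (uncurry_tensorHom_comp (MonoidalClosed.curry (eComp V X Y Z))
      (MonoidalClosed.curry (eComp V X Z W))).symm
    rw [MonoidalClosed.uncurry_natural_left, MonoidalClosed.uncurry_curry,
      MonoidalClosed.uncurry_curry, MonoidalClosed.uncurry_curry, e_assoc]

variable {D : Type v} [EnrichedCategory V D]

/-- A `Q`-weighted cone over `S : D ⟶ B` with vertex `L`: a `V`-natural transformation
`Q ⟶ B(L, S -)`. -/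
abbrev WeightedCone (Q : Weight V D) (S : EnrichedFunctor V D B) (L : B) :=
  WeightHom Q (S.comp V (representable V L))

lemma uncurry_hom_representable (S : EnrichedFunctor V D B) (X : B) (d d' : D) :
    MonoidalClosed.uncurry (Weight.hom (S.comp V (representable V X)) d d') =
      (X ⟶[V] S.obj d) ◁ S.map d d' ≫ eComp V X (S.obj d) (S.obj d') := by
  refine (MonoidalClosed.uncurry_natural_left (S.map d d')
    (MonoidalClosed.curry (eComp V X (S.obj d) (S.obj d')))).trans ?_
  rw [MonoidalClosed.uncurry_curry]

/-- The components `Q d ⟶ B(L, S d)` of a weighted cone. -/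
def WeightedCone.leg {Q : Weight V D} {S : EnrichedFunctor V D B} {L : B}
    (c : WeightedCone Q S L) (d : D) : Q.obj d ⟶ (L ⟶[V] S.obj d) :=
  c.app d

lemma WeightedCone.uncurry_naturality {Q : Weight V D} {S : EnrichedFunctor V D B} {L : B}
    (c : WeightedCone Q S L) (d d' : D) :
    MonoidalClosed.uncurry (Q.hom d d') ≫ c.leg d' =
      c.leg d ▷ _ ≫ (L ⟶[V] S.obj d) ◁ S.map d d' ≫ eComp V L (S.obj d) (S.obj d') :=
  (WeightHom.uncurry_naturality c d d').trans
    (congrArg (c.leg d ▷ _ ≫ ·) (uncurry_hom_representable S L d d'))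

variable {A : Type u₂} [EnrichedCategory V A]

/-- The image of a weighted cone under a `V`-functor `U`: the composite
`Q ⟶ B(L, S -) ⟶ A(U L, U S -)`. -/
def WeightedCone.map {Q : Weight V D} {S : EnrichedFunctor V D B} {L : B}
    (c : WeightedCone Q S L) (U : EnrichedFunctor V B A) :
    WeightedCone Q (S.comp V U) (U.obj L) where
  app d := c.leg d ≫ U.map L (S.obj d)
  naturality d d' := by
    have h : MonoidalClosed.uncurry (Q.hom d d') ≫ c.leg d' ≫ U.map L (S.obj d') =
        (c.leg d ≫ U.map L (S.obj d)) ▷ _ ≫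
          (U.obj L ⟶[V] U.obj (S.obj d)) ◁ (S.map d d' ≫ U.map (S.obj d) (S.obj d')) ≫
            eComp V (U.obj L) (U.obj (S.obj d)) (U.obj (S.obj d')) := by
      rw [← Category.assoc, c.uncurry_naturality]
      simp only [Category.assoc, U.map_comp, MonoidalCategory.tensorHom_def, comp_whiskerRight,
        MonoidalCategory.whiskerLeft_comp, whisker_exchange_assoc]
    apply MonoidalClosed.uncurry_injective
    rw [MonoidalClosed.uncurry_natural_right, MonoidalClosed.uncurry_pre_app]
    exact h.trans (congrArg ((c.leg d ≫ U.map L (S.obj d)) ▷ _ ≫ ·)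
      (uncurry_hom_representable (S.comp V U) (U.obj L) d d').symm)

variable [SymmetricCategory V]

variable [HasLimits V]

/-- The morphism `B(X, L) ⟶ [D, V](Q, B(X, S -))` induced by a `Q`-weighted cone with vertex `L`;
its components `B(X, L) ⟶ [Q d, B(X, S d)]` are given by composition with the components
`Q d ⟶ B(L, S d)` of the cone. -/
def WeightedCone.comparison {Q : Weight V D} {S : EnrichedFunctor V D B} {L : B}
    (c : WeightedCone Q S L) (X : B) :
    (X ⟶[V] L) ⟶ natObj Q (S.comp V (representable V X)) :=
  natObjLift (fun d => coneTranspose (c.leg d) X) (fun d d' => by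
    apply MonoidalClosed.uncurry_injective
    have h := comparison_aux (X := X) _ _ _ _ (c.uncurry_naturality d d')
    have e (d : D) : MonoidalClosed.uncurry (coneTranspose (c.leg d) X) =
      (β_ (Q.obj d) (X ⟶[V] L)).hom ≫ (X ⟶[V] L) ◁ c.leg d ≫ eComp V X L (S.obj d) :=
      MonoidalClosed.uncurry_curry _
    rw [← e, ← e, ← uncurry_hom_representable] at h
    exact (uncurry_actRight Q (S.comp V (representable V X)) d d'
      (coneTranspose (c.leg d) X)).trans (h.trans
      (uncurry_actLeft Q (S.comp V (representable V X)) d d' (coneTranspose (c.leg d') X)).symm))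

/-- The cone `c` exhibits `L` as the limit of `S` weighted by `Q`. -/
def WeightedCone.IsLimit {Q : Weight V D} {S : EnrichedFunctor V D B} {L : B}
    (c : WeightedCone Q S L) : Prop :=
  ∀ X : B, IsIso (c.comparison X)

variable (B) in
/-- `B` has all `Q`-weighted limits. -/
def HasWeightedLimits (Q : Weight V D) : Prop :=
  ∀ S : EnrichedFunctor V D B, ∃ (L : B) (c : WeightedCone Q S L), c.IsLimit

/-- `U` preserves `Q`-weighted limits. -/
def PreservesWeightedLimits (Q : Weight V D) (U : EnrichedFunctor V B A) : Prop :=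
  ∀ ⦃S : EnrichedFunctor V D B⦄ ⦃L : B⦄ (c : WeightedCone Q S L), c.IsLimit → (c.map U).IsLimit

end WeightedLimits

/-! ### Enough cofibrantly-weighted limits -/

section Enough

variable (V : Type u) [Category.{v} V] [MonoidalCategory V]

/-- The unit `V`-category: a single object, with object of endomorphisms the unit `I`. -/
inductive UnitCat : Type
  | pt

instance : EnrichedCategory V UnitCat where
  Hom _ _ := 𝟙_ V
  id _ := 𝟙 _
  comp _ _ _ := (λ_ (𝟙_ V)).hom
  id_comp _ _ := by simp
  comp_id _ _ := by simp [unitors_equal]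
  assoc _ _ _ _ := by simp [unitors_equal]

variable [MonoidalClosed V]

/-- The `V`-functor from the unit `V`-category to `V` which selects the unit object `I`. -/
def unitWeight : EnrichedFunctor V UnitCat V where
  obj _ := 𝟙_ V
  map _ _ := eId V (𝟙_ V)
  map_id _ := Category.id_comp _
  map_comp _ _ _ := by
    apply MonoidalClosed.uncurry_injective
    refine Eq.trans ?_ (uncurry_tensorHom_comp (MonoidalClosed.id (𝟙_ V))
      (MonoidalClosed.id (𝟙_ V))).symm
    rw [MonoidalClosed.id_eq, MonoidalClosed.uncurry_curry]
    refine (MonoidalClosed.uncurry_natural_left _ (MonoidalClosed.id (𝟙_ V))).trans ?_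
    rw [MonoidalClosed.id_eq, MonoidalClosed.uncurry_curry]
    change 𝟙_ V ◁ (λ_ (𝟙_ V)).hom ≫ (ρ_ (𝟙_ V)).hom =
      (α_ (𝟙_ V) (𝟙_ V) (𝟙_ V)).inv ≫ (ρ_ (𝟙_ V)).hom ▷ 𝟙_ V ≫ (ρ_ (𝟙_ V)).hom
    rw [← triangle_assoc, Iso.inv_hom_id_assoc]

end Enough

section Enough

variable {V : Type u} [Category.{v} V] [MonoidalCategory V] [SymmetricCategory V]
  [MonoidalClosed V] [HasLimits V] [ModelCategory V]
variable {B : Type u₁} [EnrichedCategory V B] {A : Type u₂} [EnrichedCategory V A]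

/-- A cofibrant weight `Q` on `D` with a levelwise trivial fibration `Q ⟶ I P`, where
`P : D ⟶ 𝓘` is a `V`-functor to the unit `V`-category and `I P` is the composite
`D ⟶ 𝓘 ⟶ V`. -/
structure CofibrantReplacement {D : Type v} [EnrichedCategory V D]
    (P : EnrichedFunctor V D UnitCat) where
  /-- the weight -/
  Q : Weight V D
  /-- the projection -/
  q : WeightHom Q (P.comp V (unitWeight V))
  isCofibrantWeight : IsCofibrantWeight Q
  isTrivialFibration : q.IsTrivialFibration

variable (V) in
/-- A choice of a cofibrant weight as in `CofibrantReplacement` for each small `V`-category `D` over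
the unit `V`-category. -/
abbrev ReplacementChoice :=
  ∀ (D : Type v) [EnrichedCategory V D] (P : EnrichedFunctor V D UnitCat), CofibrantReplacement P

variable (B) in
/-- `B` has enough cofibrantly-weighted limits, as witnessed by the chosen weights `R`: it has all
limits weighted by the chosen weights. -/
def HasEnoughLimits (R : ReplacementChoice V) : Prop :=
  ∀ (D : Type v) [EnrichedCategory V D] (P : EnrichedFunctor V D UnitCat),
    HasWeightedLimits B (R D P).Q

/-- `U` preserves enough cofibrantly-weighted limits, namely those weighted by the chosen
weights `R`. -/
def PreservesEnoughLimits (R : ReplacementChoice V) (U : EnrichedFunctor V B A) : Prop :=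
  ∀ (D : Type v) [EnrichedCategory V D] (P : EnrichedFunctor V D UnitCat),
    PreservesWeightedLimits (R D P).Q U

end Enough

end WeakAFT

end

/-! Fix `X`. A morphism `L ⟶ Y` of the comma `V`-category `X/U` is a point of `B(L, Y)` lying over
the structure morphism of `Y` along the transposition `B(L, Y) ⟶ A(X, U Y)`; a homotopy of such
morphisms must stay over that point, which is what `HomotopicOver` records. A weak reflection of `X`
has a section of each transposition, so it is a one-element solution set. For the converse, a
solution set is a small weakly initial family in `X/U`, and Freyd's argument is run up to homotopy.
The limit of a small full subcategory `D` of `X/U`, weighted by a cofibrant replacement `Q` of the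
constant weight, lifts to `X/U` because `U` preserves it (`exists_homotopyLimit`). Points of the
trivial fibrations `Q k ⟶ I` give projections to the objects of `D`. Since `[D, V](Q, Q) ⟶ [D, V](Q,
I P)` is a trivial fibration, all endomorphisms of `Q` over the constant weight are homotopic; hence
going from the limit to `x k` and back is homotopic to the identity. Since `Q l ⟶ I` is a trivial
fibration, the projections also equalize parallel morphisms up to homotopy. Two such limits, one
over the solution set and one over a pair of objects, yield a homotopically initial object
(`exists_isHomotopyInitial`). Finally, powers turn statements about points into statements about
morphisms of `V`: maps into powers supply first the section and then the homotopy required by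
shrinkability (`CommaObj.IsHomotopyInitial.isWeakReflection`). -/

noncomputable section

namespace WeakAFT

/-! ### Homotopies between points -/

section Homotopy

variable {V : Type u} [Category.{v} V] [MonoidalCategory V] [ModelCategory V]

/-- The good cylinder of the unit object given by an interval. -/
def Interval.cylinder (J : Interval V) : Cylinder (𝟙_ V) where
  I := J.J
  i₀ := J.d
  i₁ := J.c
  π := J.e
  i₀_π := J.d_e
  i₁_π := J.c_e
  weakEquivalence_π := ⟨J.weakEquivalence_e⟩

instance (J : Interval V) : J.cylinder.IsGood where
  cofibration_i := ⟨J.cofibration_desc⟩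

/-- The interval given by a good cylinder of the unit object. -/
def Interval.ofCylinder (P : Cylinder (𝟙_ V)) [P.IsGood] : Interval V where
  J := P.I
  d := P.i₀
  c := P.i₁
  e := P.π
  d_e := P.i₀_π
  c_e := P.i₁_π
  cofibration_desc := (inferInstance : Cofibration P.i).mem
  weakEquivalence_e := P.weakEquivalence_π.mem

/-- Two points `a b : I ⟶ M` are homotopic over the point `n : I ⟶ N`, with respect to
`g : M ⟶ N`, if some homotopy between them becomes constant at `n` after composition with `g`. -/
def HomotopicOver {M N : V} (g : M ⟶ N) (n : 𝟙_ V ⟶ N) (a b : 𝟙_ V ⟶ M) : Prop :=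
  ∃ (J : Interval V) (h : J.J ⟶ M), J.d ≫ h = a ∧ J.c ≫ h = b ∧ h ≫ g = J.e ≫ n

namespace HomotopicOver

variable {M N : V} {g : M ⟶ N} {n : 𝟙_ V ⟶ N} {a b c : 𝟙_ V ⟶ M}

lemma symm (h : HomotopicOver g n a b) : HomotopicOver g n b a := by
  obtain ⟨J, h, hd, hc, hg⟩ := h
  exact ⟨.ofCylinder J.cylinder.symm, h, hc, hd, hg⟩

/-- The two intervals are glued along an endpoint; cofibrancy of the unit makes the pushout a good
cylinder again. -/
lemma trans [IsCofibrant (𝟙_ V)] (h : HomotopicOver g n a b) (h' : HomotopicOver g n b c) :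
    HomotopicOver g n a c := by
  obtain ⟨J, h, hd, hc, hg⟩ := h
  obtain ⟨J', h', hd', hc', hg'⟩ := h'
  have w : J.cylinder.i₁ ≫ h = J'.cylinder.i₀ ≫ h' := hc.trans hd'.symm
  refine ⟨.ofCylinder (J.cylinder.trans J'.cylinder),
    pushout.desc (f := J.cylinder.i₁) (g := J'.cylinder.i₀) h h' w, ?_, ?_, ?_⟩
  · exact (Category.assoc _ _ _).trans
      ((congrArg (J.cylinder.i₀ ≫ ·) (pushout.inl_desc _ _ w)).trans hd)
  · exact (Category.assoc _ _ _).trans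
      ((congrArg (J'.cylinder.i₁ ≫ ·) (pushout.inr_desc _ _ w)).trans hc')
  · refine pushout.hom_ext ?_ ?_
    · exact (pushout.inl_desc_assoc _ _ w _).trans
        (hg.trans (pushout.inl_desc_assoc _ _ _ _).symm)
    · exact (pushout.inr_desc_assoc _ _ w _).trans
        (hg'.trans (pushout.inr_desc_assoc _ _ _ _).symm)

lemma map (h : HomotopicOver g n a b) {M' N' : V} {g' : M' ⟶ N'} (k : M ⟶ M') (m : N ⟶ N')
    (w : k ≫ g' = g ≫ m) : HomotopicOver g' (n ≫ m) (a ≫ k) (b ≫ k) := by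
  obtain ⟨J, h, hd, hc, hg⟩ := h
  refine ⟨J, h ≫ k, ?_, ?_, ?_⟩
  · rw [← Category.assoc, hd]
  · rw [← Category.assoc, hc]
  · rw [Category.assoc, w, ← Category.assoc, hg, Category.assoc]

/-- The endpoint inclusion `I + I ⟶ J` is a cofibration, so the homotopy is a lift against `g`. All
homotopies in the proof originate here. -/
lemma of_trivialFibration (hg : trivialFibrations V g) (ha : a ≫ g = n) (hb : b ≫ g = n) :
    HomotopicOver g n a b := by
  obtain ⟨P, _⟩ := Cylinder.exists_very_good (𝟙_ V)
  have : Fibration g := ⟨hg.1⟩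
  have : WeakEquivalence g := ⟨hg.2⟩
  have sq : CommSq (coprod.desc a b) P.i g (P.π ≫ n) := ⟨by
    refine coprod.hom_ext ?_ ?_
    · rw [coprod.inl_desc_assoc, ha, P.inl_i_assoc, P.i₀_π_assoc]
    · rw [coprod.inr_desc_assoc, hb, P.inr_i_assoc, P.i₁_π_assoc]⟩
  refine ⟨.ofCylinder P, sq.lift, ?_, ?_, sq.fac_right⟩
  · change P.i₀ ≫ sq.lift = _
    rw [← P.inl_i, Category.assoc, sq.fac_left, coprod.inl_desc]
  · change P.i₁ ≫ sq.lift = _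
    rw [← P.inr_i, Category.assoc, sq.fac_left, coprod.inr_desc]

end HomotopicOver

lemma exists_point [IsCofibrant (𝟙_ V)] {M : V} (g : M ⟶ 𝟙_ V) (hg : trivialFibrations V g) :
    ∃ p : 𝟙_ V ⟶ M, p ≫ g = 𝟙 _ := by
  have : Fibration g := ⟨hg.1⟩
  have : WeakEquivalence g := ⟨hg.2⟩
  have sq : CommSq (initial.to M) (initial.to (𝟙_ V)) g (𝟙 _) := ⟨by ext⟩
  exact ⟨sq.lift, sq.fac_right⟩

lemma shrinkable_iff [MonoidalClosed V] {X Y : V} (f : X ⟶ Y) :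
    shrinkable V f ↔ ∃ s : Y ⟶ X, s ≫ f = 𝟙 Y ∧
      HomotopicOver ((ihom X).map f) (MonoidalClosed.curry' f)
        (MonoidalClosed.curry' (f ≫ s)) (MonoidalClosed.curry' (𝟙 X)) :=
  Iff.rfl

end Homotopy

/-! ### Composition with points -/

section Precomp

variable {V : Type u} [Category.{v} V] [MonoidalCategory V]
variable {A : Type u₂} [EnrichedCategory V A]

lemma precomp_whiskerRight_eComp {X Y : A} (a : 𝟙_ V ⟶ (X ⟶[V] Y)) (Z W : A) :
    precomp a Z ▷ (Z ⟶[V] W) ≫ eComp V X Z W = eComp V Y Z W ≫ precomp a W := by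
  simp only [precomp, comp_whiskerRight, Category.assoc]
  rw [leftUnitor_inv_naturality_assoc, whisker_exchange_assoc, ← e_assoc]
  simp [e_assoc']

lemma precomp_eId (X Z : A) : precomp (eId V X) Z = 𝟙 _ := by
  simp [precomp]

lemma comp_precomp_eId {X Y : A} (a : 𝟙_ V ⟶ (X ⟶[V] Y)) : eId V Y ≫ precomp a Y = a := by
  rw [precomp, leftUnitor_inv_naturality_assoc, whisker_exchange_assoc, unitors_inv_equal,
    ← rightUnitor_inv_naturality_assoc, e_comp_id, Category.comp_id]

lemma precomp_precomp {X Y Z : A} (a : 𝟙_ V ⟶ (X ⟶[V] Y)) (b : 𝟙_ V ⟶ (Y ⟶[V] Z)) (W : A) :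
    precomp b W ≫ precomp a W = precomp (b ≫ precomp a Z) W := by
  conv_rhs => rw [precomp]
  rw [comp_whiskerRight_assoc, precomp_whiskerRight_eComp]
  simp [precomp]

/-- Postcomposition `A(Z, X) ⟶ A(Z, Y)` with a morphism `a : I ⟶ A(X, Y)` of the underlying
category. -/
def postcomp {X Y : A} (a : 𝟙_ V ⟶ (X ⟶[V] Y)) (Z : A) : (Z ⟶[V] X) ⟶ (Z ⟶[V] Y) :=
  (ρ_ _).inv ≫ _ ◁ a ≫ eComp V Z X Y

lemma comp_postcomp {X Y Z : A} (f : 𝟙_ V ⟶ (Z ⟶[V] X)) (a : 𝟙_ V ⟶ (X ⟶[V] Y)) :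
    f ≫ postcomp a Z = a ≫ precomp f Y := by
  rw [precomp, postcomp, leftUnitor_inv_naturality_assoc, whisker_exchange_assoc,
    rightUnitor_inv_naturality_assoc, unitors_inv_equal]

variable {B : Type u₁} [EnrichedCategory V B] (U : EnrichedFunctor V B A)

/-- The morphism `B(L, Y) ⟶ A(X, U Y)` induced by `η : X ⟶ U L`. -/
abbrev transposeMap {X : A} {L : B} (η : 𝟙_ V ⟶ (X ⟶[V] U.obj L)) (Y : B) :
    (L ⟶[V] Y) ⟶ (X ⟶[V] U.obj Y) :=
  U.map L Y ≫ precomp η (U.obj Y)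

/-- This is `V`-naturality in `Y` of `B(L, Y) ⟶ A(X, U Y)`, from functoriality of `U` and
associativity. -/
lemma eComp_transposeMap {X : A} {L : B} (η : 𝟙_ V ⟶ (X ⟶[V] U.obj L)) (Y Z : B) :
    eComp V L Y Z ≫ transposeMap U η Z =
      transposeMap U η Y ▷ _ ≫ _ ◁ U.map Y Z ≫ eComp V X (U.obj Y) (U.obj Z) := by
  rw [transposeMap, U.map_comp_assoc, ← precomp_whiskerRight_eComp, tensorHom_def_assoc,
    comp_whiskerRight_assoc, whisker_exchange_assoc]

lemma precomp_transposeMap {X : A} {L P : B} (η : 𝟙_ V ⟶ (X ⟶[V] U.obj L))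
    (a : 𝟙_ V ⟶ (L ⟶[V] P)) (Y : B) :
    precomp a Y ≫ transposeMap U η Y = transposeMap U (a ≫ transposeMap U η P) Y := by
  conv_lhs => rw [precomp]
  simp only [Category.assoc]
  rw [eComp_transposeMap, ← comp_whiskerRight_assoc, ← whisker_exchange_assoc,
    ← leftUnitor_inv_naturality_assoc]
  rfl

lemma postcomp_transposeMap {X : A} {L Y Z : B} (η : 𝟙_ V ⟶ (X ⟶[V] U.obj L))
    (a : 𝟙_ V ⟶ (Y ⟶[V] Z)) :
    postcomp a L ≫ transposeMap U η Z = transposeMap U η Y ≫ postcomp (a ≫ U.map Y Z) X := by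
  rw [postcomp, postcomp, Category.assoc, Category.assoc, eComp_transposeMap,
    whisker_exchange_assoc, ← rightUnitor_inv_naturality_assoc,
    MonoidalCategory.whiskerLeft_comp_assoc]

lemma eId_transposeMap {X : A} {L : B} (η : 𝟙_ V ⟶ (X ⟶[V] U.obj L)) :
    eId V L ≫ transposeMap U η L = η := by
  rw [transposeMap, U.map_id_assoc, comp_precomp_eId]

end Precomp

/-! ### Transposition and powers -/

section Closed

variable {V : Type u} [Category.{v} V] [MonoidalCategory V] [SymmetricCategory V]
  [MonoidalClosed V]
variable {A : Type u₂} [EnrichedCategory V A] {B : Type u₁} [EnrichedCategory V B]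
  (U : EnrichedFunctor V B A)

/-- `V`-naturality of transposition again, in a form that carries homotopies in `B(L, P)` to
homotopies in `[W, B(L, Y)]` over `[W, A(X, U Y)]`, and likewise for the legs of a weighted cone. -/
lemma coneTranspose_transposeMap {X : A} {L P Y : B} {W : V} (η : 𝟙_ V ⟶ (X ⟶[V] U.obj L))
    (ι : W ⟶ (P ⟶[V] Y)) :
    coneTranspose ι L ≫ (ihom W).map (transposeMap U η Y) =
      transposeMap U η P ≫ coneTranspose (ι ≫ U.map P Y) X := by
  rw [coneTranspose, coneTranspose, ← MonoidalClosed.curry_natural_right,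
    ← MonoidalClosed.curry_natural_left]
  congr 1
  simp only [Category.assoc]
  rw [eComp_transposeMap, BraidedCategory.braiding_naturality_right_assoc,
    MonoidalCategory.whiskerLeft_comp_assoc, whisker_exchange_assoc]

lemma comp_coneTranspose {P Y Z : B} {W : V} (a : 𝟙_ V ⟶ (Z ⟶[V] P)) (ι : W ⟶ (P ⟶[V] Y)) :
    a ≫ coneTranspose ι Z = MonoidalClosed.curry' (ι ≫ precomp a Y) := by
  rw [coneTranspose, ← MonoidalClosed.curry_natural_left, MonoidalClosed.curry']
  congr 1
  rw [BraidedCategory.braiding_naturality_right_assoc, precomp, leftUnitor_inv_naturality_assoc,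
    whisker_exchange_assoc, braiding_tensorUnit_right]
  simp

end Closed

section Weights

variable {V : Type u} [Category.{v} V] [MonoidalCategory V] [MonoidalClosed V]
variable {D : Type v} [EnrichedCategory V D]

/-- A constructor for `V`-natural transformations, in terms of the actions
`F d ⊗ D(d, d') ⟶ F d'`. -/
def WeightHom.ofUncurry {F G : Weight V D} (app : ∀ d, F.obj d ⟶ G.obj d)
    (h : ∀ d d', MonoidalClosed.uncurry (F.hom d d') ≫ app d' =
      app d ▷ _ ≫ MonoidalClosed.uncurry (G.hom d d')) : WeightHom F G where
  app := app
  naturality d d' := by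
    apply MonoidalClosed.uncurry_injective
    rw [MonoidalClosed.uncurry_natural_right, MonoidalClosed.uncurry_pre_app, h]

end Weights

/-! ### The comma `V`-category on a small family of objects -/

section Comma

lemma tensorHom_comp_right {V : Type u} [Category.{v} V] [MonoidalCategory V] {X X' Y Y' Y'' : V}
    (f : X ⟶ X') (g : Y ⟶ Y') (h : Y' ⟶ Y'') : (f ⊗ₘ g ≫ h) = (f ⊗ₘ g) ≫ X' ◁ h := by
  rw [← id_tensorHom, tensorHom_comp_tensorHom, Category.comp_id]

lemma tensorHom_comp_left {V : Type u} [Category.{v} V] [MonoidalCategory V] {X X' X'' Y Y' : V}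
    (f : X ⟶ X') (g : X' ⟶ X'') (h : Y ⟶ Y') : (f ≫ g ⊗ₘ h) = (f ⊗ₘ h) ≫ g ▷ Y' := by
  rw [← tensorHom_id, tensorHom_comp_tensorHom, Category.comp_id]

variable {V : Type u} [Category.{v} V] [MonoidalCategory V]
variable {A : Type u₂} [EnrichedCategory V A] {B : Type u₁} [EnrichedCategory V B]

/-- The objects of the comma `V`-category `X / U`. -/
structure CommaObj (U : EnrichedFunctor V B A) (X : A) where
  /-- the underlying object -/
  obj : B
  /-- the structure morphism `X ⟶ U obj` -/
  hom : 𝟙_ V ⟶ (X ⟶[V] U.obj obj)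

namespace CommaObj

variable {U : EnrichedFunctor V B A} {X : A}

/-- A morphism `x.obj ⟶ y.obj` underlies a morphism of `X / U`. -/
def IsHom (x y : CommaObj U X) (a : 𝟙_ V ⟶ (x.obj ⟶[V] y.obj)) : Prop :=
  a ≫ transposeMap U x.hom y.obj = y.hom

lemma IsHom.comp {x y z : CommaObj U X} {a : 𝟙_ V ⟶ (x.obj ⟶[V] y.obj)}
    {b : 𝟙_ V ⟶ (y.obj ⟶[V] z.obj)} (ha : IsHom x y a) (hb : IsHom y z b) :
    IsHom x z (b ≫ precomp a z.obj) := by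
  rw [IsHom, Category.assoc, precomp_transposeMap, ha, hb]

variable [HasPullbacks V]

/-- The hom-objects of `X / U`. -/
def homObj (x y : CommaObj U X) : V := pullback (transposeMap U x.hom y.obj) y.hom

/-- The projection to the hom-objects of `B`. -/
def homFst (x y : CommaObj U X) : homObj x y ⟶ (x.obj ⟶[V] y.obj) := pullback.fst _ _

/-- The augmentation of the hom-objects. -/
def homSnd (x y : CommaObj U X) : homObj x y ⟶ 𝟙_ V := pullback.snd _ _

lemma homCondition (x y : CommaObj U X) :
    homFst x y ≫ transposeMap U x.hom y.obj = homSnd x y ≫ y.hom :=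
  pullback.condition

/-- The universal property of the hom-objects. -/
def homLift {x y : CommaObj U X} {T : V} (f : T ⟶ (x.obj ⟶[V] y.obj)) (g : T ⟶ 𝟙_ V)
    (w : f ≫ transposeMap U x.hom y.obj = g ≫ y.hom) : T ⟶ homObj x y :=
  pullback.lift f g w

@[simp]
lemma homLift_fst {x y : CommaObj U X} {T : V} (f : T ⟶ (x.obj ⟶[V] y.obj)) (g : T ⟶ 𝟙_ V)
    (w : f ≫ transposeMap U x.hom y.obj = g ≫ y.hom) : homLift f g w ≫ homFst x y = f :=
  pullback.lift_fst _ _ _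

@[simp]
lemma homLift_snd {x y : CommaObj U X} {T : V} (f : T ⟶ (x.obj ⟶[V] y.obj)) (g : T ⟶ 𝟙_ V)
    (w : f ≫ transposeMap U x.hom y.obj = g ≫ y.hom) : homLift f g w ≫ homSnd x y = g :=
  pullback.lift_snd _ _ _

lemma hom_ext {x y : CommaObj U X} {T : V} {f g : T ⟶ homObj x y}
    (h₁ : f ≫ homFst x y = g ≫ homFst x y) (h₂ : f ≫ homSnd x y = g ≫ homSnd x y) : f = g :=
  pullback.hom_ext h₁ h₂

/-- The identities of `X / U`. -/
def homId (x : CommaObj U X) : 𝟙_ V ⟶ homObj x x :=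
  homLift (eId V x.obj) (𝟙 _) (by rw [eId_transposeMap, Category.id_comp])

/-- Composition in `B` respects the fibres over the structure morphisms, so it restricts to the
pullbacks defining the hom-objects of `X/U`. -/
lemma homSnd_comp_hom_eComp (x y z : CommaObj U X) :
    (homFst x y ⊗ₘ homFst y z) ≫ eComp V x.obj y.obj z.obj ≫ transposeMap U x.hom z.obj =
      ((homSnd x y ⊗ₘ homSnd y z) ≫ (λ_ (𝟙_ V)).hom) ≫ z.hom := by
  rw [eComp_transposeMap, tensorHom_def'_assoc, ← comp_whiskerRight_assoc, homCondition,
    whisker_exchange_assoc, ← MonoidalCategory.whiskerLeft_comp_assoc, comp_whiskerRight,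
    Category.assoc, ← whisker_exchange_assoc]
  have h : _ ◁ U.map y.obj z.obj ≫ y.hom ▷ _ ≫ eComp V X (U.obj y.obj) (U.obj z.obj) =
      (λ_ _).hom ≫ transposeMap U y.hom z.obj := by
    rw [transposeMap, precomp, ← leftUnitor_naturality_assoc, Iso.hom_inv_id_assoc]
  rw [MonoidalCategory.whiskerLeft_comp_assoc, h, leftUnitor_naturality_assoc, homCondition,
    MonoidalCategory.tensorHom_def]
  simp

/-- The composition of `X / U`. -/
def homComp (x y z : CommaObj U X) : homObj x y ⊗ homObj y z ⟶ homObj x z :=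
  homLift ((homFst x y ⊗ₘ homFst y z) ≫ eComp V x.obj y.obj z.obj)
    ((homSnd x y ⊗ₘ homSnd y z) ≫ (λ_ (𝟙_ V)).hom)
    (by rw [Category.assoc, homSnd_comp_hom_eComp])

@[simp]
lemma homId_fst (x : CommaObj U X) : homId x ≫ homFst x x = eId V x.obj := homLift_fst _ _ _

@[simp]
lemma homId_snd (x : CommaObj U X) : homId x ≫ homSnd x x = 𝟙 _ := homLift_snd _ _ _

@[simp]
lemma homComp_fst (x y z : CommaObj U X) : homComp x y z ≫ homFst x z =
    (homFst x y ⊗ₘ homFst y z) ≫ eComp V x.obj y.obj z.obj := homLift_fst _ _ _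

@[simp]
lemma homComp_snd (x y z : CommaObj U X) : homComp x y z ≫ homSnd x z =
    (homSnd x y ⊗ₘ homSnd y z) ≫ (λ_ (𝟙_ V)).hom := homLift_snd _ _ _

instance : EnrichedCategory V (CommaObj U X) where
  Hom := homObj
  id := homId
  comp := homComp
  id_comp x y := by
    apply hom_ext
    · simp only [Category.assoc, homComp_fst, Category.id_comp]
      rw [tensorHom_def_assoc, ← comp_whiskerRight_assoc, homId_fst, ← whisker_exchange_assoc,
        ← leftUnitor_inv_naturality_assoc, e_id_comp, Category.comp_id]
    · simp only [Category.assoc, homComp_snd, Category.id_comp]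
      rw [tensorHom_def_assoc, ← comp_whiskerRight_assoc, homId_snd]
      simp
  comp_id x y := by
    apply hom_ext
    · simp only [Category.assoc, homComp_fst, Category.id_comp]
      rw [tensorHom_def'_assoc, ← MonoidalCategory.whiskerLeft_comp_assoc, homId_fst,
        whisker_exchange_assoc, ← rightUnitor_inv_naturality_assoc, e_comp_id, Category.comp_id]
    · simp only [Category.assoc, homComp_snd, Category.id_comp]
      rw [tensorHom_def'_assoc, ← MonoidalCategory.whiskerLeft_comp_assoc, homId_snd]
      simp [unitors_equal]
  assoc w x y z := by
    apply hom_ext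
    · simp only [Category.assoc, homComp_fst]
      rw [← tensorHom_id, ← id_tensorHom, tensorHom_comp_tensorHom_assoc,
        tensorHom_comp_tensorHom_assoc, homComp_fst, homComp_fst, Category.id_comp,
        Category.id_comp]
      rw [tensorHom_comp_right, tensorHom_comp_left]
      simp only [Category.assoc]
      rw [← associator_inv_naturality_assoc, e_assoc]
    · simp only [Category.assoc, homComp_snd]
      rw [← tensorHom_id, ← id_tensorHom, tensorHom_comp_tensorHom_assoc,
        tensorHom_comp_tensorHom_assoc, homComp_snd, homComp_snd, Category.id_comp,
        Category.id_comp]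
      rw [tensorHom_comp_right, tensorHom_comp_left]
      simp only [Category.assoc]
      rw [← associator_inv_naturality_assoc]
      -- Augmentations compose as hom-objects of the unit `V`-category do, so its associativity law
      -- is what remains.
      exact congrArg (_ ≫ ·) (e_assoc V UnitCat.pt .pt .pt .pt)

end CommaObj

variable {U : EnrichedFunctor V B A} {X : A}

/-- The full sub-`V`-category of `X / U` on a family of objects. -/
def CommaFamily {K : Type v} (_ : K → CommaObj U X) : Type v := K

namespace CommaFamily

open CommaObj

variable {K : Type v} (x : K → CommaObj U X) [HasPullbacks V]

instance : EnrichedCategory V (CommaFamily x) where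
  Hom k l := homObj (x k) (x l)
  id k := homId (x k)
  comp k l m := homComp (x k) (x l) (x m)
  id_comp k l := e_id_comp V (x k) (x l)
  comp_id k l := e_comp_id V (x k) (x l)
  assoc k l m n := e_assoc V (x k) (x l) (x m) (x n)

/-- The projection to `B`. -/
def toBase : EnrichedFunctor V (CommaFamily x) B where
  obj k := (x k).obj
  map k l := homFst (x k) (x l)
  map_id k := homId_fst (x k)
  map_comp k l m := homComp_fst (x k) (x l) (x m)

/-- The augmentation, as a `V`-functor to the unit `V`-category. -/
def toUnit : EnrichedFunctor V (CommaFamily x) UnitCat where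
  obj _ := .pt
  map k l := homSnd (x k) (x l)
  map_id k := homId_snd (x k)
  map_comp k l m := homComp_snd (x k) (x l) (x m)

variable {x}

/-- The structure morphism of an object of the family. -/
def str (k : CommaFamily x) : 𝟙_ V ⟶ (X ⟶[V] U.obj ((toBase x).obj k)) := (x k).hom

/-- The augmentation of the hom-objects. -/
def aug (k l : CommaFamily x) : (k ⟶[V] l) ⟶ 𝟙_ V := homSnd (x k) (x l)

lemma toBase_map_transposeMap (k l : CommaFamily x) :
    (toBase x).map k l ≫ transposeMap U k.str ((toBase x).obj l) = aug k l ≫ l.str :=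
  homCondition (x k) (x l)

lemma eComp_aug (k l m : CommaFamily x) :
    eComp V k l m ≫ aug k m = (aug k l ⊗ₘ aug l m) ≫ (λ_ (𝟙_ V)).hom :=
  homComp_snd (x k) (x l) (x m)

lemma exists_lift {k l : CommaFamily x} {T : V}
    (f : T ⟶ ((toBase x).obj k ⟶[V] (toBase x).obj l)) (g : T ⟶ 𝟙_ V)
    (w : f ≫ transposeMap U k.str ((toBase x).obj l) = g ≫ l.str) :
    ∃ h : T ⟶ (k ⟶[V] l), h ≫ (toBase x).map k l = f ∧ h ≫ aug k l = g :=
  ⟨homLift (x := x k) (y := x l) f g w, homLift_fst _ _ _, homLift_snd _ _ _⟩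

lemma hom_ext {k l : CommaFamily x} {T : V} {f g : T ⟶ (k ⟶[V] l)}
    (h₁ : f ≫ (toBase x).map k l = g ≫ (toBase x).map k l) (h₂ : f ≫ aug k l = g ≫ aug k l) :
    f = g :=
  CommaObj.hom_ext (x := x k) (y := x l) h₁ h₂

variable [MonoidalClosed V]

lemma uncurry_hom_unitWeight (k l : CommaFamily x) :
    MonoidalClosed.uncurry (Weight.hom ((toUnit x).comp V (unitWeight V)) k l) =
      𝟙_ V ◁ aug k l ≫ (λ_ (𝟙_ V)).hom := by
  refine (MonoidalClosed.uncurry_natural_left (aug k l) (MonoidalClosed.id (𝟙_ V))).trans ?_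
  rw [MonoidalClosed.id_eq, MonoidalClosed.uncurry_curry, unitors_equal]

variable (x) in
/-- The structure morphisms `X ⟶ U x`, as a cone of shape `CommaFamily x` with constant weight. -/
def structureCone :
    WeightedCone ((toUnit x).comp V (unitWeight V)) ((toBase x).comp V U) X :=
  .ofUncurry (fun k => k.str) fun k l => by
    rw [uncurry_hom_unitWeight]
    refine Eq.trans ?_ (congrArg (k.str ▷ _ ≫ ·)
      (uncurry_hom_representable ((toBase x).comp V U) X k l).symm)
    change (𝟙_ V ◁ aug k l ≫ (λ_ (𝟙_ V)).hom) ≫ l.str =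
      k.str ▷ (k ⟶[V] l) ≫ _ ◁ ((toBase x).map k l ≫ U.map _ _) ≫ eComp V X _ _
    rw [leftUnitor_naturality, Category.assoc, ← toBase_map_transposeMap,
      ← whisker_exchange_assoc, transposeMap, precomp,
      ← leftUnitor_naturality_assoc ((toBase x).map k l),
      ← leftUnitor_naturality_assoc (U.map _ _), Iso.hom_inv_id_assoc,
      MonoidalCategory.whiskerLeft_comp_assoc]

end CommaFamily

end Comma

/-! ### The Yoneda lemma for weights, and cones as points -/

section Weights

variable {V : Type u} [Category.{v} V] [MonoidalCategory V] [MonoidalClosed V]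
variable {D : Type v} [EnrichedCategory V D]

/-- The identity `V`-natural transformation. -/
def WeightHom.id (F : Weight V D) : WeightHom F F :=
  .ofUncurry (fun _ => 𝟙 _) (by simp)

/-- The Yoneda transformation `D(d, -) ⟶ F` given by a point of `F d`. -/
def Weight.act (F : Weight V D) {d : D} (p : 𝟙_ V ⟶ F.obj d) (d' : D) :
    (d ⟶[V] d') ⟶ F.obj d' :=
  (λ_ _).inv ≫ p ▷ _ ≫ MonoidalClosed.uncurry (F.hom d d')

lemma Weight.uncurry_hom_comp (F : Weight V D) (d d' d'' : D) :
    F.obj d ◁ eComp V d d' d'' ≫ MonoidalClosed.uncurry (F.hom d d'') =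
      (α_ _ _ _).inv ≫ MonoidalClosed.uncurry (F.hom d d') ▷ _ ≫
        MonoidalClosed.uncurry (F.hom d' d'') := by
  rw [← MonoidalClosed.uncurry_natural_left, ← uncurry_tensorHom_comp]
  exact congrArg MonoidalClosed.uncurry (F.map_comp d d' d'')

lemma Weight.eComp_act (F : Weight V D) {d : D} (p : 𝟙_ V ⟶ F.obj d) (d' d'' : D) :
    eComp V d d' d'' ≫ F.act p d'' =
      F.act p d' ▷ _ ≫ MonoidalClosed.uncurry (F.hom d' d'') := by
  rw [Weight.act, leftUnitor_inv_naturality_assoc, whisker_exchange_assoc,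
    Weight.uncurry_hom_comp, Weight.act]
  simp

/-- By Yoneda, the cone restricted along `D(d, -) ⟶ Q` is determined by its value at the identity of
`d`, the projection `L ⟶ S d` picked out by `p`. -/
lemma WeightedCone.act_leg {B : Type u₁} [EnrichedCategory V B] {Q : Weight V D}
    {S : EnrichedFunctor V D B} {L : B} (c : WeightedCone Q S L) {d : D} (p : 𝟙_ V ⟶ Q.obj d)
    (d' : D) : Q.act p d' ≫ c.leg d' = S.map d d' ≫ precomp (p ≫ c.leg d) (S.obj d') := by
  rw [Weight.act, precomp, leftUnitor_inv_naturality_assoc, whisker_exchange_assoc]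
  simp only [Category.assoc, c.uncurry_naturality, comp_whiskerRight]

variable [SymmetricCategory V] [HasLimits V]

/-- The point of `[D, V](F, G)` given by a `V`-natural transformation. -/
def WeightHom.point {F G : Weight V D} (p : WeightHom F G) : 𝟙_ V ⟶ natObj F G :=
  natObjLift (fun d => MonoidalClosed.curry' (p.app d)) fun d d' => by
    have h (d : D) : MonoidalClosed.uncurry (MonoidalClosed.curry' (p.app d)) =
        (ρ_ _).hom ≫ p.app d := MonoidalClosed.uncurry_curry _
    apply MonoidalClosed.uncurry_injective
    rw [uncurry_actRight, uncurry_actLeft, h, h, rightUnitor_naturality_assoc,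
      p.uncurry_naturality, braiding_tensorUnit_right]
    simp

@[simp]
lemma WeightHom.point_π {F G : Weight V D} (p : WeightHom F G) (d : D) :
    p.point ≫ natObjπ F G d = MonoidalClosed.curry' (p.app d) :=
  natObjLift_π _ _ d

@[simp]
lemma natObjMap_π (Q : Weight V D) {F G : Weight V D} (p : WeightHom F G) (d : D) :
    natObjMap Q p ≫ natObjπ Q G d = natObjπ Q F d ≫ (ihom (Q.obj d)).map (p.app d) :=
  natObjLift_π _ _ d

lemma natObjMap_π_assoc (Q : Weight V D) {F G : Weight V D} (p : WeightHom F G) (d : D) {Z : V}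
    (h : (ihom (Q.obj d)).obj (G.obj d) ⟶ Z) : natObjMap Q p ≫ natObjπ Q G d ≫ h =
      natObjπ Q F d ≫ (ihom (Q.obj d)).map (p.app d) ≫ h := by
  rw [← Category.assoc, natObjMap_π, Category.assoc]

lemma WeightHom.point_natObjMap_π {Q F G : Weight V D} (r : WeightHom Q F) (p : WeightHom F G)
    (d : D) : r.point ≫ natObjMap Q p ≫ natObjπ Q G d =
      MonoidalClosed.curry' (r.app d ≫ p.app d) := by
  rw [natObjMap_π, ← Category.assoc, WeightHom.point_π, MonoidalClosed.curry'_ihom_map]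

variable {B : Type u₁} [EnrichedCategory V B]

lemma WeightedCone.comparison_π {Q : Weight V D} {S : EnrichedFunctor V D B} {L : B}
    (c : WeightedCone Q S L) (X : B) (d : D) :
    c.comparison X ≫ natObjπ Q (S.comp V (representable V X)) d = coneTranspose (c.leg d) X :=
  natObjLift_π _ _ d

lemma WeightedCone.comp_comparison_π {Q : Weight V D} {S : EnrichedFunctor V D B} {L : B}
    (c : WeightedCone Q S L) {X : B} (a : 𝟙_ V ⟶ (X ⟶[V] L)) (d : D) :
    a ≫ c.comparison X ≫ natObjπ Q (S.comp V (representable V X)) d =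
      MonoidalClosed.curry' (c.leg d ≫ precomp a (S.obj d)) :=
  (congrArg (a ≫ ·) (c.comparison_π X d)).trans (comp_coneTranspose _ _)

/-- Identifies, componentwise, which morphism into the vertex a composite cone classifies. -/
lemma WeightHom.point_natObjMap_cone {Q : Weight V D} {S : EnrichedFunctor V D B} {L X : B}
    {F : Weight V D} (r : WeightHom Q F) (t : WeightedCone F S X)
    (c : WeightedCone Q S L) (a : 𝟙_ V ⟶ (X ⟶[V] L))
    (h : ∀ d, r.app d ≫ t.leg d = c.leg d ≫ precomp a (S.obj d)) :
    r.point ≫ natObjMap Q t = a ≫ c.comparison X := by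
  refine natObj_hom_ext fun d => ?_
  rw [Category.assoc, Category.assoc, WeightHom.point_natObjMap_π, c.comp_comparison_π, ← h]
  rfl

end Weights

/-! ### Homotopy limits in the comma category -/

section Limit

open CommaObj CommaFamily

variable {V : Type u} [Category.{v} V] [MonoidalCategory V] [SymmetricCategory V]
  [MonoidalClosed V] [HasLimits V] [ModelCategory V]
variable {A : Type u₂} [EnrichedCategory V A] {B : Type u₁} [EnrichedCategory V B]
  {U : EnrichedFunctor V B A} {X : A} {K : Type v} {x : K → CommaObj U X}

/-- The augmentation of a cofibrant replacement of the constant weight on `CommaFamily x`. -/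
def CofibrantReplacement.aug (r : CofibrantReplacement (toUnit x)) (k : CommaFamily x) :
    r.Q.obj k ⟶ 𝟙_ V :=
  r.q.app k

lemma CofibrantReplacement.uncurry_aug (r : CofibrantReplacement (toUnit x))
    (k l : CommaFamily x) :
    MonoidalClosed.uncurry (r.Q.hom k l) ≫ r.aug l =
      r.aug k ▷ _ ≫ 𝟙_ V ◁ CommaFamily.aug k l ≫ (λ_ _).hom :=
  (r.q.uncurry_naturality k l).trans (congrArg (r.aug k ▷ _ ≫ ·) (uncurry_hom_unitWeight k l))

lemma CofibrantReplacement.act_aug (r : CofibrantReplacement (toUnit x)) {k : CommaFamily x}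
    {p : 𝟙_ V ⟶ r.Q.obj k} (hp : p ≫ r.aug k = 𝟙 _) (l : CommaFamily x) :
    r.Q.act p l ≫ r.aug l = CommaFamily.aug k l := by
  rw [Weight.act, Category.assoc, Category.assoc, r.uncurry_aug, ← comp_whiskerRight_assoc, hp]
  simp

variable (r : CofibrantReplacement (toUnit x)) {L : B} (c : WeightedCone r.Q (toBase x) L)

/-- The structure cone restricted along `Q ⟶ I P` is a `Q`-weighted cone with vertex `X`, so it
factors through the limit `U L`. The second clause says that each leg `Q k ⟶ B(L, x k)` lies over
the structure morphism of `x k`. -/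
lemma exists_commaObj_of_isLimit_map (hU : (c.map U).IsLimit) :
    ∃ η : 𝟙_ V ⟶ (X ⟶[V] U.obj L),
      r.q.point ≫ natObjMap r.Q (structureCone x) = η ≫ (c.map U).comparison X ∧
      ∀ k : CommaFamily x, c.leg k ≫ transposeMap U η ((toBase x).obj k) = r.aug k ≫ k.str := by
  have := hU X
  obtain ⟨η, hη⟩ : ∃ η, r.q.point ≫ natObjMap r.Q (structureCone x) =
      η ≫ (c.map U).comparison X :=
    ⟨r.q.point ≫ natObjMap r.Q (structureCone x) ≫ inv ((c.map U).comparison X), by simp⟩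
  refine ⟨η, hη, fun k => ?_⟩
  apply MonoidalClosed.curry'_injective
  have h := (c.map U).comp_comparison_π η k
  rw [← Category.assoc, ← hη, Category.assoc, WeightHom.point_natObjMap_π] at h
  exact (congrArg MonoidalClosed.curry' (Category.assoc _ _ _).symm).trans h.symm

variable {r c} {η : 𝟙_ V ⟶ (X ⟶[V] U.obj L)}

/-- A morphism `ψ` from a vertex `x k` of the diagram to the vertex `L` of the cone induces an
endomorphism `Q ⟶ D(k, -) ⟶ Q` of the weight. -/
lemma exists_weightHom
    (hη : ∀ k : CommaFamily x,
      c.leg k ≫ transposeMap U η ((toBase x).obj k) = r.aug k ≫ k.str)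
    {k : CommaFamily x} {p : 𝟙_ V ⟶ r.Q.obj k} (hp : p ≫ r.aug k = 𝟙 _)
    {ψ : 𝟙_ V ⟶ ((toBase x).obj k ⟶[V] L)} (hψ : ψ ≫ transposeMap U k.str L = η) :
    ∃ t : WeightHom r.Q r.Q, (∀ l, t.app l ≫ r.aug l = r.aug l) ∧
      ∀ l, t.app l ≫ c.leg l =
        c.leg l ≫ precomp (ψ ≫ precomp (p ≫ c.leg k) L) ((toBase x).obj l) := by
  -- As `ψ` is a morphism of `X/U`, precomposing the leg at `l` with it stays over the structure
  -- morphism of `x l`, hence factors through the pullback `D(k, l)`.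
  have ex (l : CommaFamily x) : ∃ s : r.Q.obj l ⟶ (k ⟶[V] l),
      s ≫ (toBase x).map k l = c.leg l ≫ precomp ψ _ ∧ s ≫ CommaFamily.aug k l = r.aug l :=
    exists_lift _ _ (by rw [Category.assoc, precomp_transposeMap, hψ, hη])
  choose s hs₁ hs₂ using ex
  have hs (l m : CommaFamily x) : MonoidalClosed.uncurry (r.Q.hom l m) ≫ s m =
      s l ▷ _ ≫ eComp V k l m := by
    refine CommaFamily.hom_ext ?_ ?_
    · rw [Category.assoc, Category.assoc, hs₁, EnrichedFunctor.map_comp,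
        MonoidalCategory.tensorHom_def_assoc, ← comp_whiskerRight_assoc, hs₁,
        ← Category.assoc, c.uncurry_naturality, Category.assoc, Category.assoc,
        ← precomp_whiskerRight_eComp, comp_whiskerRight_assoc, whisker_exchange_assoc]
    · rw [Category.assoc, Category.assoc, hs₂, eComp_aug, r.uncurry_aug,
        MonoidalCategory.tensorHom_def_assoc, ← comp_whiskerRight_assoc, hs₂]
  refine ⟨.ofUncurry (fun l => s l ≫ r.Q.act p l) fun l m => ?_, fun l => ?_, fun l => ?_⟩
  · rw [← Category.assoc, hs, Category.assoc, Weight.eComp_act, comp_whiskerRight_assoc]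
  · change (s l ≫ r.Q.act p l) ≫ r.aug l = _
    rw [Category.assoc, r.act_aug hp, hs₂]
  · change (s l ≫ r.Q.act p l) ≫ c.leg l = _
    rw [Category.assoc, c.act_leg, ← Category.assoc, hs₁, Category.assoc, precomp_precomp]

/-- The round trip `L ⟶ x k ⟶ L` is classified by an endomorphism of `Q` over the constant weight,
as is the identity of `L`. Cofibrancy of `Q` makes the two endomorphisms homotopic over `q`. -/
lemma homotopicOver_eId (hc : c.IsLimit) (hU : (c.map U).IsLimit)
    (hη₀ : r.q.point ≫ natObjMap r.Q (structureCone x) = η ≫ (c.map U).comparison X)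
    (hη : ∀ k : CommaFamily x,
      c.leg k ≫ transposeMap U η ((toBase x).obj k) = r.aug k ≫ k.str)
    {k : CommaFamily x} {p : 𝟙_ V ⟶ r.Q.obj k} (hp : p ≫ r.aug k = 𝟙 _)
    {ψ : 𝟙_ V ⟶ ((toBase x).obj k ⟶[V] L)} (hψ : ψ ≫ transposeMap U k.str L = η) :
    HomotopicOver (transposeMap U η L) η (ψ ≫ precomp (p ≫ c.leg k) L) (eId V L) := by
  obtain ⟨t, ht₁, ht₂⟩ := exists_weightHom hη hp hψ
  have := hc L
  have := hU X
  have H : HomotopicOver (natObjMap r.Q r.q) r.q.point t.point (WeightHom.id r.Q).point := by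
    refine .of_trivialFibration (r.isCofibrantWeight r.q r.isTrivialFibration)
      (natObj_hom_ext fun l => ?_) (natObj_hom_ext fun l => ?_)
    · rw [Category.assoc, WeightHom.point_natObjMap_π, WeightHom.point_π]
      exact congrArg MonoidalClosed.curry' (ht₁ l)
    · rw [Category.assoc, WeightHom.point_natObjMap_π, WeightHom.point_π]
      exact congrArg MonoidalClosed.curry' (Category.id_comp _)
  -- Transport along `[D, V](Q, Q) ⟶ [D, V](Q, B(L, S -)) ≅ B(L, L)`, which lies over `[D, V](Q, I
  -- P) ⟶ [D, V](Q, A(X, U S -)) ≅ A(X, U L)`.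
  have H' := H.map (g' := transposeMap U η L) (natObjMap r.Q c ≫ inv (c.comparison L))
    (natObjMap r.Q (structureCone x) ≫ inv ((c.map U).comparison X)) (by
      -- Relating `f` and `g` by the comparison map keeps its inverse out of the componentwise
      -- calculation.
      have key (T : V) (f : T ⟶ natObj r.Q r.Q) (g : T ⟶ (L ⟶[V] L))
          (hfg : f ≫ natObjMap r.Q c = g ≫ c.comparison L) :
          g ≫ transposeMap U η L ≫ (c.map U).comparison X =
            f ≫ natObjMap r.Q r.q ≫ natObjMap r.Q (structureCone x) := by
        refine natObj_hom_ext fun l => ?_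
        have h₁ := congrArg (· ≫ natObjπ _ _ l) hfg
        simp only [Category.assoc, natObjMap_π, c.comparison_π] at h₁
        have h₂ : f ≫ natObjπ r.Q r.Q l ≫ (ihom (r.Q.obj l)).map (c.leg l) =
          g ≫ coneTranspose (c.leg l) L := h₁
        have h₃ : g ≫ transposeMap U η L ≫
            coneTranspose (c.leg l ≫ U.map L ((toBase x).obj l)) X =
            f ≫ natObjπ r.Q r.Q l ≫ (ihom (r.Q.obj l)).map (r.aug l ≫ l.str) := by
          rw [← coneTranspose_transposeMap, ← Category.assoc, ← h₂, ← hη]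
          simp only [Category.assoc, Functor.map_comp]
        simp only [Category.assoc] at h₃
        simp only [Category.assoc, natObjMap_π, natObjMap_π_assoc, (c.map U).comparison_π]
        exact h₃.trans
          (congrArg (fun z => f ≫ natObjπ r.Q r.Q l ≫ z) (Functor.map_comp _ _ _))
      rw [← cancel_mono ((c.map U).comparison X)]
      simp only [Category.assoc, IsIso.inv_hom_id, Category.comp_id]
      have := key _ (𝟙 _) (natObjMap r.Q c ≫ inv (c.comparison L)) (by simp)
      simpa only [Category.assoc, Category.id_comp] using this)
  have e₁ : r.q.point ≫ natObjMap r.Q (structureCone x) ≫ inv ((c.map U).comparison X) = η := by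
    rw [← Category.assoc, hη₀, Category.assoc, IsIso.hom_inv_id, Category.comp_id]
  have e₂ : t.point ≫ natObjMap r.Q c ≫ inv (c.comparison L) =
      ψ ≫ precomp (p ≫ c.leg k) L := by
    rw [← Category.assoc, WeightHom.point_natObjMap_cone t c c _ ht₂, Category.assoc,
      IsIso.hom_inv_id, Category.comp_id]
  have e₃ : (WeightHom.id r.Q).point ≫ natObjMap r.Q c ≫ inv (c.comparison L) = eId V L := by
    rw [← Category.assoc, WeightHom.point_natObjMap_cone (WeightHom.id r.Q) c c (eId V L)
      (fun d => ?_), Category.assoc, IsIso.hom_inv_id, Category.comp_id]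
    rw [precomp_eId, Category.comp_id]
    exact Category.id_comp _
  rwa [e₁, e₂, e₃] at H'

/-- The morphisms are points of `D(k, l)` of augmentation one. The Yoneda map `D(k, l) ⟶ Q l` given
by `p` sends them into one fibre of the trivial fibration `Q l ⟶ I`, where they are homotopic; the
leg at `l` carries the homotopy to `B(L, x l)`. -/
lemma homotopicOver_of_parallel
    (hη : ∀ k : CommaFamily x,
      c.leg k ≫ transposeMap U η ((toBase x).obj k) = r.aug k ≫ k.str)
    {k l : CommaFamily x} {p : 𝟙_ V ⟶ r.Q.obj k} (hp : p ≫ r.aug k = 𝟙 _)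
    {a b : 𝟙_ V ⟶ ((toBase x).obj k ⟶[V] (toBase x).obj l)}
    (ha : a ≫ transposeMap U k.str _ = l.str) (hb : b ≫ transposeMap U k.str _ = l.str) :
    HomotopicOver (transposeMap U η ((toBase x).obj l)) l.str
      (a ≫ precomp (p ≫ c.leg k) _) (b ≫ precomp (p ≫ c.leg k) _) := by
  obtain ⟨a', rfl, ha'⟩ := exists_lift a (𝟙 _) (by rw [ha, Category.id_comp])
  obtain ⟨b', rfl, hb'⟩ := exists_lift b (𝟙 _) (by rw [hb, Category.id_comp])
  have H : HomotopicOver (r.aug l) (𝟙 _) (a' ≫ r.Q.act p l) (b' ≫ r.Q.act p l) :=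
    .of_trivialFibration (r.isTrivialFibration l)
      (by rw [Category.assoc, r.act_aug hp, ha']) (by rw [Category.assoc, r.act_aug hp, hb'])
  simpa only [Category.assoc, c.act_leg, Category.id_comp] using H.map (c.leg l) l.str (hη l)

variable (x) in
/-- The limit of a small diagram in `X / U`, weighted by the chosen cofibrant replacement of the
constant weight. -/
theorem exists_homotopyLimit [IsCofibrant (𝟙_ V)] (R : ReplacementChoice V)
    (hB : HasEnoughLimits B R) (hU : PreservesEnoughLimits R U) :
    ∃ (ℓ : CommaObj U X) (π : ∀ k, 𝟙_ V ⟶ (ℓ.obj ⟶[V] (x k).obj)),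
      (∀ k, IsHom ℓ (x k) (π k)) ∧
      (∀ k l a b, IsHom (x k) (x l) a → IsHom (x k) (x l) b →
        HomotopicOver (transposeMap U ℓ.hom (x l).obj) (x l).hom
          (a ≫ precomp (π k) _) (b ≫ precomp (π k) _)) ∧
      ∀ k ψ, IsHom (x k) ℓ ψ →
        HomotopicOver (transposeMap U ℓ.hom ℓ.obj) ℓ.hom (ψ ≫ precomp (π k) _) (eId V ℓ.obj) := by
  obtain ⟨L, c, hc⟩ := hB (CommaFamily x) (toUnit x) (toBase x)
  have hcU := hU (CommaFamily x) (toUnit x) c hc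
  obtain ⟨η, hη₀, hη⟩ := exists_commaObj_of_isLimit_map _ c hcU
  -- These points of the `Q k` turn the legs of the cone into actual projections.
  choose p hp using fun k : CommaFamily x =>
    exists_point ((R (CommaFamily x) (toUnit x)).aug k)
      ((R (CommaFamily x) (toUnit x)).isTrivialFibration k)
  refine ⟨⟨L, η⟩, fun k => p k ≫ c.leg k, fun k => ?_, fun k l a b ha hb => ?_, fun k ψ hψ => ?_⟩
  · refine (Category.assoc _ _ _).trans ((congrArg (p k ≫ ·) (hη k)).trans ?_)
    exact (Category.assoc _ _ _).symm.trans
      ((congrArg (· ≫ CommaFamily.str (x := x) k) (hp k)).trans (Category.id_comp _))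
  · exact homotopicOver_of_parallel hη (hp k) ha hb
  · exact homotopicOver_eId hc hcU hη₀ hη (hp k) hψ

end Limit

/-! ### Homotopically initial objects and weak reflections -/

section Initial

open CommaObj

variable {V : Type u} [Category.{v} V] [MonoidalCategory V] [SymmetricCategory V]
  [MonoidalClosed V] [ModelCategory V]
variable {A : Type u₂} [EnrichedCategory V A] {B : Type u₁} [EnrichedCategory V B]
  {U : EnrichedFunctor V B A} {X : A}

/-- An object of `X / U` is homotopically initial if it admits a morphism to each object, any two
such morphisms being homotopic. -/
def CommaObj.IsHomotopyInitial (ℓ : CommaObj U X) : Prop :=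
  ∀ y : CommaObj U X, (∃ a, IsHom ℓ y a) ∧ ∀ a b, IsHom ℓ y a → IsHom ℓ y b →
    HomotopicOver (transposeMap U ℓ.hom y.obj) y.hom a b

/-- The limit `ℓ` over the solution set is weakly initial. For uniqueness, `p : E ⟶ ℓ` equalizes `a`
and `b` up to homotopy and has a homotopy section `φ`, whence `a ∼ a p φ ∼ b p φ ∼ b`. -/
theorem exists_isHomotopyInitial [HasLimits V] [IsCofibrant (𝟙_ V)] (R : ReplacementChoice V)
    (hB : HasEnoughLimits B R) (hU : PreservesEnoughLimits R U) {K : Type v}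
    (x : K → CommaObj U X) (hx : ∀ y : CommaObj U X, ∃ k a, IsHom (x k) y a) :
    ∃ ℓ : CommaObj U X, ℓ.IsHomotopyInitial := by
  obtain ⟨ℓ, π, hπ, -, hid⟩ := exists_homotopyLimit x R hB hU
  refine ⟨ℓ, fun y => ⟨?_, fun a b ha hb => ?_⟩⟩
  · obtain ⟨k, a, ha⟩ := hx y
    exact ⟨_, (hπ k).comp ha⟩
  -- The full subcategory on `ℓ` and `y` contains both `a` and `b`, so its limit serves as a
  -- homotopy equalizer.
  obtain ⟨E, ρ, hρ, hpar, -⟩ :=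
    exists_homotopyLimit (fun i : ULift.{v} Bool => cond i.down ℓ y) R hB hU
  obtain ⟨k, ψ, hψ⟩ := hx E
  let p : 𝟙_ V ⟶ (E.obj ⟶[V] ℓ.obj) := ρ ⟨true⟩
  have hp : IsHom E ℓ p := hρ ⟨true⟩
  let φ := ψ ≫ precomp (π k) E.obj
  have hφ : IsHom ℓ E φ := (hπ k).comp hψ
  -- `p φ` is `(p ψ) π k`, a round trip from `ℓ` through `x k`, so it is homotopic to the identity.
  have H₁ : HomotopicOver (transposeMap U ℓ.hom ℓ.obj) ℓ.hom
      (p ≫ precomp φ ℓ.obj) (eId V ℓ.obj) := by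
    have := hid k _ (hψ.comp hp)
    rwa [Category.assoc, precomp_precomp] at this
  have H₂ (a : 𝟙_ V ⟶ (ℓ.obj ⟶[V] y.obj)) (ha : IsHom ℓ y a) :
      HomotopicOver (transposeMap U ℓ.hom y.obj) y.hom
        (a ≫ precomp (p ≫ precomp φ ℓ.obj) y.obj) a := by
    have := H₁.map (g' := transposeMap U ℓ.hom y.obj) _ _ (postcomp_transposeMap U ℓ.hom a)
    rw [comp_postcomp, comp_postcomp, comp_postcomp, precomp_eId, Category.comp_id] at this
    rwa [Category.assoc, show a ≫ U.map ℓ.obj y.obj ≫ precomp ℓ.hom (U.obj y.obj) = y.hom from ha]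
      at this
  have H₃ : HomotopicOver (transposeMap U ℓ.hom y.obj) y.hom
      (a ≫ precomp (p ≫ precomp φ ℓ.obj) y.obj) (b ≫ precomp (p ≫ precomp φ ℓ.obj) y.obj) := by
    have h : HomotopicOver (transposeMap U E.hom y.obj) y.hom
      (a ≫ precomp p y.obj) (b ≫ precomp p y.obj) := hpar ⟨true⟩ ⟨false⟩ a b ha hb
    have := h.map (g' := transposeMap U ℓ.hom y.obj) (precomp φ y.obj) (𝟙 _)
      (by rw [precomp_transposeMap, hφ, Category.comp_id])
    simpa only [Category.assoc, precomp_precomp, Category.comp_id] using this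
  exact (H₂ a ha).symm.trans (H₃.trans (H₂ b hb))

/-- A homotopically initial object of `X / U` is a weak reflection of `X` along `U`. -/
theorem CommaObj.IsHomotopyInitial.isWeakReflection {ℓ : CommaObj U X}
    (hℓ : ℓ.IsHomotopyInitial) (hB : HasPowers V B) (hU : PreservesPowers U) :
    IsWeakReflection (shrinkable V) U ℓ.hom := by
  intro Y
  rw [shrinkable_iff]
  -- With `P` the power of `Y` by `W`, preservation makes `U P` the power of `U Y`, so `f` amounts
  -- to a morphism `X ⟶ U P`, an object of `X/U`.
  have lift {W : V} (f : W ⟶ (X ⟶[V] U.obj Y)) : ∃ (y : CommaObj U X)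
      (ι : W ⟶ (y.obj ⟶[V] Y)), IsPower ι ∧ IsPower (ι ≫ U.map _ _) ∧
        y.hom ≫ coneTranspose (ι ≫ U.map _ _) X = MonoidalClosed.curry' f := by
    obtain ⟨P, ι, hι⟩ := hB W Y
    have hι' := hU ι hι
    have := hι' X
    exact ⟨⟨P, MonoidalClosed.curry' f ≫ inv (coneTranspose (ι ≫ U.map P Y) X)⟩, ι, hι, hι',
      by simp⟩
  have fac {W : V} {y : CommaObj U X} (ι : W ⟶ (y.obj ⟶[V] Y)) (a : 𝟙_ V ⟶ (ℓ.obj ⟶[V] y.obj)) :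
      (a ≫ transposeMap U ℓ.hom y.obj) ≫ coneTranspose (ι ≫ U.map _ _) X =
        MonoidalClosed.curry' ((ι ≫ precomp a Y) ≫ transposeMap U ℓ.hom Y) := by
    rw [Category.assoc, ← coneTranspose_transposeMap, ← Category.assoc, comp_coneTranspose,
      MonoidalClosed.curry'_ihom_map]
  -- The identity of `A(X, U Y)` gives an object of `X/U`; a morphism to it from `ℓ` is exactly a
  -- section.
  obtain ⟨s, hs⟩ : ∃ s, s ≫ transposeMap U ℓ.hom Y = 𝟙 _ := by
    obtain ⟨y, ι, -, -, hy⟩ := lift (𝟙 (X ⟶[V] U.obj Y))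
    obtain ⟨a, ha⟩ := (hℓ y).1
    refine ⟨ι ≫ precomp a Y, MonoidalClosed.curry'_injective ?_⟩
    rw [← fac, ha, hy]
  refine ⟨s, hs, ?_⟩
  -- For the power by `B(ℓ, Y)`, morphisms `ℓ ⟶ y` are the endomorphisms of `B(ℓ, Y)` over `A(X, U
  -- Y)`. Both the identity and transposition followed by `s` are such, so initiality makes them
  -- homotopic.
  obtain ⟨y, ι, hι, hι', hy⟩ := lift (transposeMap U ℓ.hom Y)
  have := hι ℓ.obj
  have := hι' X
  have hom (t : (ℓ.obj ⟶[V] Y) ⟶ (ℓ.obj ⟶[V] Y))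
      (ht : t ≫ transposeMap U ℓ.hom Y = transposeMap U ℓ.hom Y) :
      ∃ a, IsHom ℓ y a ∧ a ≫ coneTranspose ι ℓ.obj = MonoidalClosed.curry' t := by
    have e : (MonoidalClosed.curry' t ≫ inv (coneTranspose ι ℓ.obj)) ≫ coneTranspose ι ℓ.obj =
      MonoidalClosed.curry' t := by simp
    refine ⟨_, ?_, e⟩
    rw [IsHom, ← cancel_mono (coneTranspose (ι ≫ U.map y.obj Y) X), hy, Category.assoc,
      ← coneTranspose_transposeMap, ← Category.assoc, e, MonoidalClosed.curry'_ihom_map, ht]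
  obtain ⟨a, ha, ha'⟩ := hom (transposeMap U ℓ.hom Y ≫ s)
    (by rw [Category.assoc, hs, Category.comp_id])
  obtain ⟨b, hb, hb'⟩ := hom (𝟙 _) (Category.id_comp _)
  have H := ((hℓ y).2 a b ha hb).map _ _ (coneTranspose_transposeMap U ℓ.hom ι)
  rwa [ha', hb', hy] at H

end Initial

/-! ### The solution set condition -/

section SolutionSet

variable {V : Type u} [Category.{v} V] [MonoidalCategory V]
variable {A : Type u₂} [EnrichedCategory V A] {B : Type u₁} [EnrichedCategory V B]
  (U : EnrichedFunctor V B A)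

lemma homOf_comp_forget_map {X : A} {Y Z : B} (f : 𝟙_ V ⟶ (X ⟶[V] U.obj Y))
    (g : 𝟙_ V ⟶ (Y ⟶[V] Z)) :
    ForgetEnrichment.homOf V f ≫ U.forget.map (ForgetEnrichment.homOf V g) =
      ForgetEnrichment.homOf V (g ≫ transposeMap U f Z) := by
  refine (ForgetEnrichment.homOf_comp V f (g ≫ U.map Y Z)).symm.trans (congrArg _ ?_)
  rw [transposeMap, precomp, leftUnitor_inv_naturality_assoc, leftUnitor_inv_naturality_assoc,
    MonoidalCategory.tensorHom_def', MonoidalCategory.whiskerLeft_comp]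
  simp only [Category.assoc]

/-- A solution set for `X` is a small weakly initial family in `X/U`. -/
lemma solutionSetCondition_forget_iff :
    SolutionSetCondition.{v} U.forget ↔ ∀ X : A, ∃ (K : Type v) (x : K → CommaObj U X),
      ∀ y : CommaObj U X, ∃ k a, CommaObj.IsHom (x k) y a := by
  constructor
  · intro h X
    obtain ⟨K, b, f, hf⟩ := h (ForgetEnrichment.of V X)
    refine ⟨K, fun k => ⟨ForgetEnrichment.to V (b k), ForgetEnrichment.homTo V (f k)⟩,
      fun y => ?_⟩
    obtain ⟨k, g, hg⟩ := hf (ForgetEnrichment.of V y.obj) (ForgetEnrichment.homOf V y.hom)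
    exact ⟨k, ForgetEnrichment.homTo V g, (homOf_comp_forget_map U _ _).symm.trans hg⟩
  · intro h X
    obtain ⟨K, x, hx⟩ := h (ForgetEnrichment.to V X)
    refine ⟨K, fun k => ForgetEnrichment.of V (x k).obj,
      fun k => ForgetEnrichment.homOf V (x k).hom, fun Y f => ?_⟩
    obtain ⟨k, a, ha⟩ := hx ⟨ForgetEnrichment.to V Y, ForgetEnrichment.homTo V f⟩
    exact ⟨k, ForgetEnrichment.homOf V a, (homOf_comp_forget_map U _ _).trans ha⟩

end SolutionSet

end WeakAFT

end

/-! ### The adjoint functor theorem -/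

theorem mainTheorem1 {V : Type u} [Category.{v} V] [MonoidalCategory V] [SymmetricCategory V]
    [MonoidalClosed V] [ModelCategory V] [HasLimits V] [HasColimits V]
    [WeakAFT.MonoidalModelCategory V]
    {B : Type u₁} [EnrichedCategory V B] {A : Type u₂} [EnrichedCategory V A]
    (U : EnrichedFunctor V B A)
    (hB : WeakAFT.HasPowers V B) (hU : WeakAFT.PreservesPowers U)
    (R : WeakAFT.ReplacementChoice V)
    (hRB : WeakAFT.HasEnoughLimits B R) (hRU : WeakAFT.PreservesEnoughLimits R U) :
    WeakAFT.HasWeakLeftAdjoint (WeakAFT.shrinkable V) U ↔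
      SolutionSetCondition.{v} U.forget := by
  rw [WeakAFT.solutionSetCondition_forget_iff]
  refine forall_congr' fun X => ⟨?_, ?_⟩
  · rintro ⟨X', η, hη⟩
    refine ⟨PUnit, fun _ => ⟨X', η⟩, fun y => ⟨⟨⟩, ?_⟩⟩
    obtain ⟨s, hs, -⟩ := hη y.obj
    -- Sections of the transpositions already make the reflection weakly initial.
    exact ⟨y.hom ≫ s, (Category.assoc _ _ _).trans
      ((congrArg (y.hom ≫ ·) hs).trans (Category.comp_id _))⟩
  · rintro ⟨K, x, hx⟩
    have := WeakAFT.MonoidalModelCategory.isCofibrant_unit (V := V)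
    obtain ⟨ℓ, hℓ⟩ := WeakAFT.exists_isHomotopyInitial R hRB hRU x hx
    exact ⟨ℓ.obj, ℓ.hom, hℓ.isWeakReflection hB hU⟩
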